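/- Consider a network of $n$ anonymous nodes whose communication graph is the complete graph $K_n$, in the synchronous beeping model $B_{cd}L$: in each slot every active node either beeps or listens; a beeping node learns whether or not some neighbour beeped in the same slot, and a listening node learns only whether or not at least one neighbour beeped. All nodes start in the same slot, draw independent random bits, and run the following algorithm. Each node has variables $counted=\mathrm{false}$, $terminated=\mathrm{false}$, $k=2$, $size=1$ (initial values), and repeats the following phase of three slots until $terminated=\mathrm{true}$: Slot 1: if $counted=\mathrm{false}$, beep with probability $1/k$ (independently of everything else). Slot 2: if the node was the only one to beep in slot 1, it beeps and sets $counted\gets\mathrm{true}$. Slot 3: if $counted=\mathrm{false}$, beep. End of phase: if a neighbour beeped in slot 2, then $size\gets size+1$. If no node beeped in slot 3, then $terminated\gets\mathrm{true}$. If no node beeped in slot 1, then $k\gets k-1$ provided $k>2$; otherwise, if there was a collision in slot 1 (detected directly by a node that beeped in slot 1, and inferred by a listening node when it heard a beep in slot 1 and nobody beeped in slot 2), then $k\gets k+1$. A node that listens in a slot is silent in it; a node that has terminated stays silent. **Theorem.** The algorithm is a Las Vegas algorithm for counting: for every $n$, in every execution, every node that has terminated has $size=n$, and with probability $1$ all nodes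 terminate. Moreover, with high probability, i.e. with probability $1-o(1/n)$ as $n\to\infty$, the execution ends, with every node terminated and $size=n$, within at most $55n$ phases, that is within $165n$ slots. -/

import Mathlib

open MeasureTheory Filter Asymptotics

noncomputable section

namespace Beeping

/-- What a node learns in one slot in the model `B_cd L`. A beeping node detects whether some
neighbour beeped in the same slot; a listening node only distinguishes silence from the
presence of at least one beep. -/
inductive Observation where
  | beepedAlone
  | beepedWithOthers
  | heardSilence
  | heardBeep
  deriving DecidableEq

/-- A uniform randomised beeping algorithm for the model `B_cd L`: every node runs this same local
program from the same initial state. In each slot it is given a fresh uniform random number in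
`[0,1]`, decides from its state and that number whether it beeps (otherwise it listens), and then
updates its state from what it observed. -/
structure Algorithm where
  State : Type
  init : State
  beeps : State → unitInterval → Prop
  receive : State → Observation → State
  terminated : State → Prop
  output : State → ℕ

section Semantics

variable {V : Type*} (A : Algorithm) (G : SimpleGraph V)

/-- Node `v` beeps in a slot that starts in configuration `c`, the random numbers drawn in this slot
being `u`. A node that has terminated stays passive. -/
def beepsAt (c : V → A.State) (u : V → unitInterval) (v : V) : Prop :=
  ¬ A.terminated (c v) ∧ A.beeps (c v) (u v)

open Classical in
/-- What node `v` observes in that slot. -/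
def observation (c : V → A.State) (u : V → unitInterval) (v : V) : Observation :=
  if beepsAt A c u v then
    if ∃ w, G.Adj v w ∧ beepsAt A c u w then .beepedWithOthers else .beepedAlone
  else
    if ∃ w, G.Adj v w ∧ beepsAt A c u w then .heardBeep else .heardSilence

open Classical in
/-- One synchronous slot. -/
def slotStep (c : V → A.State) (u : V → unitInterval) : V → A.State := fun v =>
  if A.terminated (c v) then c v else A.receive (c v) (observation A G c u v)

/-- The configuration after `t` slots, when `ω t v` is the random number drawn by node `v` in the
slot with index `t` (indices start at `0`). -/
def config (ω : ℕ → V → unitInterval) : ℕ → V → A.State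
  | 0 => fun _ => A.init
  | t + 1 => slotStep A G (config ω t) (ω t)

end Semantics

/-- The law of the random numbers: all of them independent and uniform on `[0,1]`. -/
def randomness (V : Type*) [Fintype V] : Measure (ℕ → V → unitInterval) :=
  Measure.infinitePi fun _ : ℕ => Measure.pi fun _ : V => (volume : Measure unitInterval)

/-- The current slot of the phase, with what was observed in the earlier slots of the phase. -/
inductive Slot where
  | one
  | two (o₁ : Observation)
  | three (o₁ o₂ : Observation)

/-- The local variables of a node in the counting algorithm. -/
structure NodeState where
  counted : Bool
  terminated : Bool
  k : ℕ
  size : ℕ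
  slot : Slot

/-- A neighbour of the observing node beeped. -/
def Observation.neighborBeeped (o : Observation) : Prop :=
  o = .heardBeep ∨ o = .beepedWithOthers

/-- Neither the observing node nor a neighbour of it beeped. -/
def Observation.noOneBeeped (o : Observation) : Prop :=
  o = .heardSilence

/-- There was a collision in slot 1, as a node finds out from its observations in slots 1 and 2: a
node that beeped in slot 1 detects it directly, a node that listened heard a beep in slot 1 which
was not confirmed in slot 2. -/
def collisionInSlotOne (o₁ o₂ : Observation) : Prop :=
  o₁ = .beepedWithOthers ∨ (o₁ = .heardBeep ∧ o₂.noOneBeeped)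

/-- When a node beeps. In slot 1 an uncounted node beeps with probability `1 / k`. -/
def countingBeeps (s : NodeState) (u : unitInterval) : Prop :=
  match s.slot with
  | .one => s.counted = false ∧ (u : ℝ) < 1 / (s.k : ℝ)
  | .two o₁ => o₁ = .beepedAlone
  | .three _ _ => s.counted = false

open Classical in
/-- The computation at the end of a phase, `o₁ o₂ o₃` being the observations in its slots. -/
def endOfPhase (s : NodeState) (o₁ o₂ o₃ : Observation) : NodeState where
  counted := s.counted
  terminated := if o₃.noOneBeeped then true else s.terminated
  k :=
    if o₁.noOneBeeped then
      if s.k > 2 then s.k - 1 else s.k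
    else if collisionInSlotOne o₁ o₂ then s.k + 1 else s.k
  size := if o₂.neighborBeeped then s.size + 1 else s.size
  slot := .one

/-- The state update at the end of a slot. -/
def countingReceive (s : NodeState) (o : Observation) : NodeState :=
  match s.slot with
  | .one => { s with slot := .two o }
  | .two o₁ =>
      { s with
        counted := if o₁ = .beepedAlone then true else s.counted
        slot := .three o₁ o }
  | .three o₁ o₂ => endOfPhase s o₁ o₂ o

/-- The counting algorithm with adaptive probability. -/
def counting : Algorithm where
  State := NodeState
  init := { counted := false, terminated := false, k := 2, size := 1, slot := .one }
  beeps := countingBeeps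
  receive := countingReceive
  terminated s := s.terminated = true
  output s := s.size

/-- After `t` slots every node has terminated and its output is the number of nodes. -/
def Solved {V : Type*} [Fintype V] (A : Algorithm) (G : SimpleGraph V)
    (ω : ℕ → V → unitInterval) (t : ℕ) : Prop :=
  ∀ v, A.terminated (config A G ω t v) ∧ A.output (config A G ω t v) = Fintype.card V

end Beeping

end

/-! ### Reduction: on a complete graph each phase is one step of a chain on global states -/

namespace Beeping

/-! On a complete graph all active nodes classify slot 1 alike: silence, a single beep, or a
collision. Hence `k` stays common to all nodes, and a phase is determined by the set of uncounted
nodes, `k`, and the slot-1 beepers (`config_three_mul`). This deterministic description already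
gives correctness of the output: `size` always equals the number of counted nodes, plus one for a
node not yet counted, and termination occurs exactly when nobody is uncounted.

For the running time let `m` be the number of uncounted nodes and consider `3 ^ m * ((6/5) ^ (k - m)
+ (6/5) ^ (m - k))`, set to `0` at `m = 0`. The factor `3 ^ m` rewards a successful count; the
symmetric sum penalises `k` being far from `m`. If `k` and `m` are comparable, a success is likely
enough; if `k` is much too large, silence lowers it, and if much too small, collisions raise it. In
every case one phase multiplies the expected potential by at most `24/25` (`potential_drift`).

Slot-1 randomness is independent of the past, so the expectation decays geometrically
(`lintegral_energy_after_le`). The potential is at least `1` while a node is uncounted, so Markov's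
inequality bounds the failure probability after `t` phases by `(24/25) ^ t` times the initial
potential, which is at most `2 * (18/5) ^ n`. Letting `t` grow gives almost sure termination, and `t
= 55 n` gives failure probability at most `2 * (1/2) ^ n`. -/

open Classical in
/-- The observation of node `v` of a complete graph in a slot in which exactly the nodes of `B`
beep. -/
noncomputable def observationOf {V : Type*} (B : Finset V) (v : V) : Observation :=
  if v ∈ B then if B = {v} then .beepedAlone else .beepedWithOthers
  else if B = ∅ then .heardSilence else .heardBeep

/-- All other nodes are neighbours, so a node hears a beep exactly when `B` has a member other than
itself. -/
theorem observation_top_eq {V : Type*} (A : Algorithm) (c : V → A.State) (u : V → unitInterval)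
    (B : Finset V) (hB : ∀ v, beepsAt A c u v ↔ v ∈ B) (v : V) :
    observation A (⊤ : SimpleGraph V) c u v = observationOf B v := by
  classical
  unfold observation observationOf
  simp only [hB, SimpleGraph.top_adj]
  by_cases hv : v ∈ B
  · have : (∃ w, v ≠ w ∧ w ∈ B) ↔ ¬ B = {v} := by
      rw [Finset.eq_singleton_iff_unique_mem]
      push Not
      constructor
      · rintro ⟨w, h, hw⟩
        exact fun _ => ⟨w, hw, h.symm⟩
      · intro h
        obtain ⟨w, hw, h⟩ := h hv
        exact ⟨w, h.symm, hw⟩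
    simp only [hv, if_true, this]
    split_ifs <;> rfl
  · have : (∃ w, v ≠ w ∧ w ∈ B) ↔ ¬ B = ∅ := by
      rw [← ne_eq, ← Finset.nonempty_iff_ne_empty]
      constructor
      · rintro ⟨w, h, hw⟩
        exact ⟨w, hw⟩
      · rintro ⟨w, hw⟩
        exact ⟨w, fun h => hv (h ▸ hw), hw⟩
    simp only [hv, if_false, this]
    split_ifs <;> rfl

/-- The global state of the counting algorithm between two phases: the set of uncounted nodes, and
the common value of the variable `k`. -/
@[ext]
structure CountState (V : Type*) where
  uncounted : Finset V
  k : ℕ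

namespace CountState

variable {V : Type*}

open Classical in
/-- The nodes that beep in slot 1. -/
noncomputable def beepers (s : CountState V) (u : V → unitInterval) : Finset V :=
  s.uncounted.filter fun v => (u v : ℝ) < 1 / (s.k : ℝ)

open Classical in
/-- The global state after a phase with random numbers `u` in slot 1. -/
noncomputable def next (s : CountState V) (u : V → unitInterval) : CountState V :=
  if s.uncounted = ∅ then s
  else if (s.beepers u).card = 0 then ⟨s.uncounted, if s.k > 2 then s.k - 1 else s.k⟩
  else if (s.beepers u).card = 1 then ⟨s.uncounted \ s.beepers u, s.k⟩
  else ⟨s.uncounted, s.k + 1⟩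

theorem beepers_subset (s : CountState V) (u : V → unitInterval) :
    s.beepers u ⊆ s.uncounted :=
  Finset.filter_subset _ _

theorem observationOf_eq_beepedAlone {B : Finset V} {v : V} :
    observationOf B v = .beepedAlone ↔ B = {v} := by
  unfold observationOf
  by_cases h : B = {v}
  · simp [h]
  · simp only [h, if_false, iff_false]
    split_ifs <;> simp

open Classical in
/-- The nodes that beep in slot 2, if those in `B` beep in slot 1. -/
noncomputable def confirmers (B : Finset V) : Finset V := if B.card = 1 then B else ∅

theorem mem_confirmers {B : Finset V} {v : V} : v ∈ confirmers B ↔ B = {v} := by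
  unfold confirmers
  constructor
  · intro h
    split_ifs at h with hB
    · obtain ⟨a, rfl⟩ := Finset.card_eq_one.1 hB
      simp_all
    · simp at h
  · rintro rfl
    simp

variable [Fintype V]

open Classical in
/-- The local variables of node `v` between two phases. -/
noncomputable def node (s : CountState V) (v : V) : NodeState where
  counted := decide (v ∉ s.uncounted)
  terminated := decide (s.uncounted = ∅)
  k := s.k
  -- An uncounted node includes itself from the start. On being counted it hears no neighbour in
  -- slot 2, and the lost summand is offset by the growth of the complement.
  size := s.uncountedᶜ.card + if v ∈ s.uncounted then 1 else 0
  slot := .one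

/-- The global state after `t` phases. -/
noncomputable def after (ω : ℕ → V → unitInterval) : ℕ → CountState V
  | 0 => ⟨Finset.univ, 2⟩
  -- Only slot 1 of a phase, with index `3 * t`, uses random numbers.
  | t + 1 => (after ω t).next (ω (3 * t))

/-- The configuration after slot 1 of a phase that starts in `s`, if `B` are the nodes that
beep. -/
noncomputable def nodeAfterOne (s : CountState V) (B : Finset V) (v : V) : NodeState :=
  { s.node v with slot := .two (observationOf B v) }

open Classical in
/-- The configuration after slot 2 of a phase that starts in `s`, if `B` are the nodes that beep in
slot 1. -/
noncomputable def nodeAfterTwo (s : CountState V) (B : Finset V) (v : V) : NodeState :=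
  { s.node v with
    counted := decide (v ∉ s.uncounted \ confirmers B)
    slot := .three (observationOf B v) (observationOf (confirmers B) v) }

theorem slotStep_of_terminated (s : CountState V) (hs : s.uncounted = ∅) (u : V → unitInterval) :
    slotStep counting (⊤ : SimpleGraph V) s.node u = s.node := by
  funext v
  simp [slotStep, counting, node, hs]

theorem slotStep_one (s : CountState V) (hs : s.uncounted ≠ ∅) (u : V → unitInterval) :
    slotStep counting (⊤ : SimpleGraph V) s.node u = s.nodeAfterOne (s.beepers u) := by
  funext v
  have h : ∀ v, beepsAt counting s.node u v ↔ v ∈ s.beepers u := by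
    intro v
    simp [beepsAt, counting, countingBeeps, node, beepers, hs]
  have ho := observation_top_eq counting s.node u _ h v
  have ht : ¬ counting.terminated (s.node v) := by simp [counting, node, hs]
  refine (if_neg ht).trans ?_
  rw [ho]
  rfl

theorem slotStep_two (s : CountState V) (hs : s.uncounted ≠ ∅) (u u' : V → unitInterval) :
    slotStep counting (⊤ : SimpleGraph V) (s.nodeAfterOne (s.beepers u)) u' =
      s.nodeAfterTwo (s.beepers u) := by
  classical
  funext v
  set B := s.beepers u with hB
  have h : ∀ v, beepsAt counting (s.nodeAfterOne B) u' v ↔ v ∈ confirmers B := by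
    intro v
    simp [beepsAt, counting, countingBeeps, nodeAfterOne, node, hs, observationOf_eq_beepedAlone,
      mem_confirmers]
  have ho := observation_top_eq counting (s.nodeAfterOne B) u' _ h v
  have ht : ¬ counting.terminated (s.nodeAfterOne B v) := by
    simp [counting, nodeAfterOne, node, hs]
  refine (if_neg ht).trans ?_
  rw [ho]
  simp only [counting, countingReceive, nodeAfterOne, nodeAfterTwo, observationOf_eq_beepedAlone,
    Finset.mem_sdiff, mem_confirmers, node]
  by_cases h1 : B = {v} <;> simp [h1]

/-- The end-of-phase tests give every node the same verdict on slot 1, so `k` remains common;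
silence in slot 3 means that nobody is left uncounted. -/
theorem slotStep_three (s : CountState V) (hs : s.uncounted ≠ ∅) (u u' : V → unitInterval) :
    slotStep counting (⊤ : SimpleGraph V) (s.nodeAfterTwo (s.beepers u)) u' =
      (s.next u).node := by
  classical
  funext v
  have hsub := s.beepers_subset u
  have hnext : s.next u = if (s.beepers u).card = 0 then
        ⟨s.uncounted, if s.k > 2 then s.k - 1 else s.k⟩
      else if (s.beepers u).card = 1 then ⟨s.uncounted \ s.beepers u, s.k⟩
      else ⟨s.uncounted, s.k + 1⟩ := by
    simp [next, hs]
  set B := s.beepers u with hB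
  have h : ∀ v, beepsAt counting (s.nodeAfterTwo B) u' v ↔ v ∈ s.uncounted \ confirmers B := by
    intro v
    simp only [beepsAt, counting, countingBeeps, nodeAfterTwo, node, hs]
    simp
  have ho := observation_top_eq counting (s.nodeAfterTwo B) u' _ h v
  have ht : ¬ counting.terminated (s.nodeAfterTwo B v) := by
    simp [counting, nodeAfterTwo, node, hs]
  refine (if_neg ht).trans ?_
  rw [ho, hnext]
  have hsil : ∀ C : Finset V, ∀ w, (observationOf C w).noOneBeeped ↔ C = ∅ := by
    intro C w
    unfold observationOf Observation.noOneBeeped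
    by_cases hC : C = ∅
    · simp [hC]
    · simp only [hC, if_false, iff_false]
      split_ifs <;> simp
  have hnb : ∀ C : Finset V, ∀ w,
      (observationOf C w).neighborBeeped ↔ C ≠ ∅ ∧ C ≠ {w} := by
    intro C w
    unfold observationOf Observation.neighborBeeped
    by_cases hw : w ∈ C
    · have : C ≠ ∅ := Finset.ne_empty_of_mem hw
      by_cases hC : C = {w} <;> simp [hw, hC, this]
    · have : C ≠ {w} := by rintro rfl; simp at hw
      by_cases hC : C = ∅ <;> simp [hw, hC, this]
  -- A lone beeper would confirm in slot 2, so for a listener a beep followed by silence means at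
  -- least two beepers.
  have hcol : collisionInSlotOne (observationOf B v) (observationOf (confirmers B) v) ↔
      B.card ≠ 0 ∧ B.card ≠ 1 := by
    unfold collisionInSlotOne
    rw [hsil]
    by_cases h1 : B.card = 1
    · obtain ⟨a, ha⟩ := Finset.card_eq_one.1 h1
      simp only [ha, confirmers, observationOf]
      by_cases hav : v = a <;> simp [hav]
    · have : confirmers B = ∅ := by simp [confirmers, h1]
      have h2 : B ≠ {v} := by rintro h2; simp [h2] at h1
      simp only [this, observationOf, h2, if_false]
      by_cases hv : v ∈ B
      · have := Finset.card_ne_zero_of_mem hv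
        simp [hv, this, h1]
      · by_cases h0 : B = ∅ <;> simp [hv, h0, h1]
  simp only [counting, countingReceive, nodeAfterTwo, endOfPhase, hsil, hnb, hcol, node]
  by_cases h0 : B.card = 0
  · have hB0 : B = ∅ := Finset.card_eq_zero.1 h0
    simp [hB0, confirmers, hs]
  by_cases h1 : B.card = 1
  · obtain ⟨a, ha⟩ := Finset.card_eq_one.1 h1
    have haS : a ∈ s.uncounted := hsub (by simp [ha])
    have hcard : ((s.uncounted \ {a})ᶜ).card = (s.uncountedᶜ).card + 1 := by
      have : (s.uncounted \ {a})ᶜ = insert a s.uncountedᶜ := by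
        ext x; simp; tauto
      rw [this, Finset.card_insert_of_notMem (by simpa using haS)]
    simp only [ha, confirmers, Finset.card_singleton, if_true]
    by_cases hva : v = a
    · subst hva
      simp [haS, hcard]
      exact Or.inl
    · have hav : ¬ a = v := fun h => hva h.symm
      by_cases hvS : v ∈ s.uncounted <;> simp [hva, hav, hvS, hs, hcard]
  · have hB0 : B ≠ ∅ := fun h => h0 (by simp [h])
    simp [hB0, h0, h1, confirmers, hs]

theorem config_three_mul (ω : ℕ → V → unitInterval) (t : ℕ) :
    config counting (⊤ : SimpleGraph V) ω (3 * t) = (after ω t).node := by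
  classical
  induction t with
  | zero =>
    funext v
    have : Nonempty V := ⟨v⟩
    have h0 : (Finset.univ : Finset V) ≠ ∅ := Finset.univ_nonempty.ne_empty
    simp [config, after, node, counting, h0]
  | succ t ih =>
    have : 3 * (t + 1) = 3 * t + 1 + 1 + 1 := by ring
    rw [this]
    simp only [config, ih, after]
    by_cases hs : (after ω t).uncounted = ∅
    · simp only [slotStep_of_terminated _ hs]
      simp [next, hs]
      rfl
    · rw [slotStep_one _ hs, slotStep_two _ hs, slotStep_three _ hs]

/-- Termination happens only at the end of a phase and for all nodes at once, so a node found
terminated in mid-phase was so when the phase began. -/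
theorem output_eq_of_terminated (ω : ℕ → V → unitInterval) (t : ℕ) (v : V)
    (h : counting.terminated (config counting (⊤ : SimpleGraph V) ω t v)) :
    counting.output (config counting (⊤ : SimpleGraph V) ω t v) = Fintype.card V := by
  classical
  obtain ⟨q, r, hr, rfl⟩ : ∃ q r, r < 3 ∧ t = 3 * q + r :=
    ⟨t / 3, t % 3, Nat.mod_lt _ (by norm_num), (Nat.div_add_mod t 3).symm⟩
  have key : ∀ v, (after ω q).uncounted = ∅ →
      counting.output ((after ω q).node v) = Fintype.card V := by
    intro v hs
    simp [counting, node, hs]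
  by_cases hs : (after ω q).uncounted = ∅
  · have : config counting (⊤ : SimpleGraph V) ω (3 * q + r) = (after ω q).node := by
      interval_cases r <;> simp only [config, config_three_mul, slotStep_of_terminated _ hs, add_zero] <;>
        rfl
    rw [this]
    exact key v hs
  · exfalso
    interval_cases r
    · rw [add_zero, config_three_mul] at h
      simp [counting, node, hs] at h
    · simp only [config, config_three_mul, slotStep_one _ hs] at h
      simp [counting, nodeAfterOne, node, hs] at h
    · simp only [config, config_three_mul, slotStep_one _ hs, slotStep_two _ hs] at h
      simp [counting, nodeAfterTwo, node, hs] at h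

theorem solved_three_mul (ω : ℕ → V → unitInterval) (t : ℕ) (hs : (after ω t).uncounted = ∅) :
    Solved counting (⊤ : SimpleGraph V) ω (3 * t) := by
  intro v
  have h : counting.terminated (config counting (⊤ : SimpleGraph V) ω (3 * t) v) := by
    rw [config_three_mul]
    simp [counting, node, hs]
  exact ⟨h, output_eq_of_terminated ω _ v h⟩

end CountState

/-! ### The Lyapunov function -/

/-- The Lyapunov function of the counting algorithm, for `m` uncounted nodes. -/
noncomputable def potential (m k : ℕ) : ℝ :=
  if m = 0 then 0 else 3 ^ m * ((6 / 5 : ℝ) ^ ((k : ℤ) - m) + (6 / 5 : ℝ) ^ ((m : ℤ) - k))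

theorem potential_nonneg (m k : ℕ) : 0 ≤ potential m k := by
  unfold potential
  split_ifs
  · exact le_rfl
  · positivity

/-- One of the two opposite exponents is nonnegative. This is the threshold for Markov's inequality.
-/
theorem one_le_potential {m : ℕ} (hm : m ≠ 0) (k : ℕ) : 1 ≤ potential m k := by
  have h3 : (1 : ℝ) ≤ 3 ^ m := one_le_pow₀ (by norm_num)
  have hsum : (1 : ℝ) ≤ (6 / 5 : ℝ) ^ ((k : ℤ) - m) + (6 / 5 : ℝ) ^ ((m : ℤ) - k) := by
    rcases le_total (m : ℤ) k with h | h
    · have := one_le_zpow₀ (a := (6 / 5 : ℝ)) (by norm_num) (sub_nonneg.2 h)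
      have : (0 : ℝ) < (6 / 5 : ℝ) ^ ((m : ℤ) - k) := by positivity
      linarith
    · have := one_le_zpow₀ (a := (6 / 5 : ℝ)) (by norm_num) (sub_nonneg.2 h)
      have : (0 : ℝ) < (6 / 5 : ℝ) ^ ((k : ℤ) - m) := by positivity
      linarith
  rw [potential, if_neg hm]
  nlinarith

/-! ### Binomial estimates and the one-phase drift -/

section Binomial

variable {k : ℕ}

theorem one_sub_inv_pow_self_le (hk : 2 ≤ k) : (1 - 1 / (k : ℝ)) ^ k ≤ 37 / 100 := by
  have hk0 : (0 : ℝ) < k := by positivity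
  have h1 : 1 - 1 / (k : ℝ) ≤ Real.exp (-(1 / k)) := by
    have := Real.add_one_le_exp (-(1 / (k : ℝ)))
    linarith
  have h0 : 0 ≤ 1 - 1 / (k : ℝ) := by
    rw [sub_nonneg, div_le_one hk0]
    exact_mod_cast (by omega : 1 ≤ k)
  calc (1 - 1 / (k : ℝ)) ^ k ≤ Real.exp (-(1 / k)) ^ k := pow_le_pow_left₀ h0 h1 k
    _ = Real.exp (-1) := by
      rw [← Real.exp_nat_mul]
      congr 1
      field_simp
    _ ≤ 37 / 100 := by
      have := Real.exp_neg_one_lt_d9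
      linarith

/-- Bernoulli's inequality with real exponent `k / 2 ≥ 1` gives `1/2`; then square. -/
theorem quarter_le_one_sub_inv_pow_self (hk : 2 ≤ k) : 1 / 4 ≤ (1 - 1 / (k : ℝ)) ^ k := by
  have hk2 : (2 : ℝ) ≤ k := by exact_mod_cast hk
  have h0 : (0 : ℝ) ≤ 1 - 1 / (k : ℝ) := by
    rw [sub_nonneg, div_le_one (by linarith)]
    linarith
  have h := one_add_mul_self_le_rpow_one_add (s := -(1 / (k : ℝ))) (by linarith)
    (p := (k : ℝ) / 2) (by linarith)
  have h2 : 1 + (k : ℝ) / 2 * -(1 / (k : ℝ)) = 1 / 2 := by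
    field_simp
    norm_num
  rw [h2, ← sub_eq_add_neg] at h
  have h3 : ((1 - 1 / (k : ℝ)) ^ ((k : ℝ) / 2)) ^ 2 = (1 - 1 / (k : ℝ)) ^ k := by
    rw [← Real.rpow_natCast, ← Real.rpow_mul h0, ← Real.rpow_natCast]
    congr 1
    push_cast
    ring
  rw [← h3]
  nlinarith

/-- With `k = j + 1`, the base is the inverse of `1 + 1/j`, so its `j`-th power is at least `1/e >
9/25`. Square this and use `2/3` for the remaining factor. -/
theorem one_sub_inv_pow_two_mul_sub_one_ge (hk : 2 ≤ k) :
    43 / 500 ≤ (1 - 1 / (k : ℝ)) ^ (2 * k - 1) := by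
  obtain rfl | hk3 : k = 2 ∨ 3 ≤ k := by omega
  · norm_num
  obtain ⟨j, rfl⟩ : ∃ j, k = j + 1 := ⟨k - 1, by omega⟩
  have hj2 : (2 : ℝ) ≤ j := by exact_mod_cast (by omega : 2 ≤ j)
  have hj0 : (0 : ℝ) < j := by linarith
  have hq : 1 - 1 / ((j + 1 : ℕ) : ℝ) = (1 / (j : ℝ) + 1)⁻¹ := by
    push_cast
    field_simp
    ring
  have hexp : (1 / (j : ℝ) + 1) ^ j ≤ 25 / 9 := by
    calc (1 / (j : ℝ) + 1) ^ j ≤ Real.exp (1 / j) ^ j :=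
          pow_le_pow_left₀ (by positivity) (Real.add_one_le_exp _) j
      _ = Real.exp 1 := by
        rw [← Real.exp_nat_mul]
        congr 1
        field_simp
      _ ≤ 25 / 9 := by
        have := Real.exp_one_lt_d9
        linarith
  have hpow : 9 / 25 ≤ (1 - 1 / ((j + 1 : ℕ) : ℝ)) ^ j := by
    rw [hq, inv_pow]
    have := inv_anti₀ (by positivity) hexp
    linarith
  have hqge : 2 / 3 ≤ 1 - 1 / ((j + 1 : ℕ) : ℝ) := by
    have : 1 / ((j + 1 : ℕ) : ℝ) ≤ 1 / 3 := by
      apply one_div_le_one_div_of_le (by norm_num)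
      push_cast
      linarith
    linarith
  rw [show 2 * (j + 1) - 1 = j * 2 + 1 by omega, pow_succ, pow_mul]
  generalize 1 - 1 / ((j + 1 : ℕ) : ℝ) = q at *
  have : (9 / 25) ^ 2 ≤ (q ^ j) ^ 2 := pow_le_pow_left₀ (by norm_num) hpow 2
  nlinarith

/-- The inequality behind the drift of `potential`, after division by `3 ^ m`, where `X` and `Y`
stand for `(6 / 5) ^ (k - m)` and its inverse, and `p₀`, `p₁` are the probabilities that none and
exactly one of `m` uncounted nodes beep. -/
theorem drift_aux {m : ℕ} (hm : 1 ≤ m) (hk : 2 ≤ k) {X Y p₀ p₁ : ℝ} (hX : 0 < X) (hY : 0 < Y)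
    (hp₀ : p₀ = (1 - 1 / (k : ℝ)) ^ m)
    (hp₁ : p₁ = m * (1 / (k : ℝ)) * (1 - 1 / (k : ℝ)) ^ (m - 1))
    (hXY : X = (6 / 5 : ℝ) ^ ((k : ℤ) - m)) (hYX : Y = (6 / 5 : ℝ) ^ ((m : ℤ) - k)) :
    p₀ * (X * (5 / 6) + Y * (6 / 5)) + (p₁ / 3 + (1 - p₀ - p₁)) * (X * (6 / 5) + Y * (5 / 6)) ≤
      24 / 25 * (X + Y) := by
  have hk2 : (2 : ℝ) ≤ k := by exact_mod_cast hk
  have hm1 : (1 : ℝ) ≤ m := by exact_mod_cast hm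
  set q : ℝ := 1 - 1 / (k : ℝ) with hq
  have hik : 1 / (k : ℝ) ≤ 1 / 2 := one_div_le_one_div_of_le (by norm_num) hk2
  have hik0 : 0 < 1 / (k : ℝ) := by positivity
  have hq2 : 1 / 2 ≤ q := by rw [hq]; linarith
  have hq1 : q ≤ 1 := by rw [hq]; linarith
  have hp₀0 : 0 ≤ p₀ := by rw [hp₀]; positivity
  have hp₁0 : 0 ≤ p₁ := by rw [hp₁]; positivity
  have hratio : ∀ j : ℕ, ∀ a b : ℤ, a - b = j →
      (6 / 5 : ℝ) ^ a = (6 / 5 : ℝ) ^ b * (6 / 5 : ℝ) ^ j := by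
    intro j a b h
    rw [← zpow_natCast, ← zpow_add₀ (by norm_num)]
    congr 1
    omega
  have hp₁p₀ : m * (1 / (k : ℝ)) * p₀ ≤ p₁ := by
    rw [hp₀, hp₁]
    exact mul_le_mul_of_nonneg_left (pow_le_pow_of_le_one (by linarith) hq1 (by omega))
      (by positivity)
  rcases le_or_gt m k with hmk | hmk
  · have hxle : m * (1 / (k : ℝ)) ≤ 1 := by
      rw [mul_one_div, div_le_one (by linarith)]
      exact_mod_cast hmk
    have hbern : 1 - m * (1 / (k : ℝ)) ≤ p₀ := by
      have := one_add_mul_le_pow (a := -(1 / (k : ℝ))) (by linarith) m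
      rw [hp₀, hq]
      calc _ = 1 + (m : ℝ) * -(1 / (k : ℝ)) := by ring
        _ ≤ _ := this
        _ = _ := by ring
    have hquarter : 1 / 4 ≤ p₀ := by
      rw [hp₀]
      exact (quarter_le_one_sub_inv_pow_self hk).trans
        (pow_le_pow_of_le_one (by linarith) hq1 hmk)
    have hj : X = Y * (6 / 5 : ℝ) ^ (2 * (k - m)) := by
      rw [hXY, hYX]
      exact hratio _ _ _ (by push_cast [hmk]; ring)
    -- For `k ≥ 5 m` silence has probability at least `4/5` and `X` dominates `Y`, so the gain from
    -- a success can be dropped.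
    rcases le_or_gt (5 * m) k with h5 | h5
    · have hx5 : m * (1 / (k : ℝ)) ≤ 1 / 5 := by
        rw [mul_one_div, div_le_div_iff₀ (by linarith) (by norm_num)]
        have : ((5 * m : ℕ) : ℝ) ≤ k := by exact_mod_cast h5
        push_cast at this
        linarith
      have h8 : (6 / 5 : ℝ) ^ 8 ≤ (6 / 5 : ℝ) ^ (2 * (k - m)) :=
        pow_le_pow_right₀ (by norm_num) (by omega)
      have h8' : (4 : ℝ) ≤ (6 / 5 : ℝ) ^ 8 := by norm_num
      have h4 : 4 * Y ≤ X := by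
        rw [hj]
        nlinarith
      have : p₀ * (X * (5 / 6) + Y * (6 / 5)) + (1 - p₀) * (X * (6 / 5) + Y * (5 / 6)) ≤
          24 / 25 * (X + Y) := by
        nlinarith
      nlinarith
    · have hx5 : 1 / 5 ≤ m * (1 / (k : ℝ)) := by
        rw [mul_one_div, div_le_div_iff₀ (by norm_num) (by linarith)]
        have : (k : ℝ) < ((5 * m : ℕ) : ℝ) := by exact_mod_cast h5
        push_cast at this
        linarith
      have hYle : Y ≤ X := by
        rw [hj]
        exact le_mul_of_one_le_right hY.le (one_le_pow₀ (by norm_num))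
      -- With `a`, `b` the coefficients of `X`, `Y`, write `a X + b Y = a (X - Y) + (a + b) Y`; as
      -- `Y ≤ X`, it suffices that `a ≤ 24/25` and `a + b ≤ 48/25`. The case `k < m ≤ 2 k` is the
      -- same with `X` and `Y` exchanged.
      have hXc : p₀ * (5 / 6) + (1 - p₀ - 2 / 3 * p₁) * (6 / 5) ≤ 24 / 25 := by
        generalize m * (1 / (k : ℝ)) = x at *
        nlinarith
      have hsum : p₀ * (5 / 6) + (1 - p₀ - 2 / 3 * p₁) * (6 / 5) + (p₀ * (6 / 5) +
          (1 - p₀ - 2 / 3 * p₁) * (5 / 6)) ≤ 48 / 25 := by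
        generalize m * (1 / (k : ℝ)) = x at *
        nlinarith
      nlinarith
  · have hself := one_sub_inv_pow_self_le hk
    rw [← hq] at hself
    have hj : Y = X * (6 / 5 : ℝ) ^ (2 * (m - k)) := by
      rw [hXY, hYX]
      exact hratio _ _ _ (by push_cast [hmk.le]; ring)
    have hp₀le : p₀ ≤ 37 / 100 := by
      rw [hp₀]
      exact (pow_le_pow_of_le_one (by linarith) hq1 hmk.le).trans hself
    rcases le_or_gt m (2 * k) with h2 | h2
    · have hXle : X ≤ Y := by
        rw [hj]
        exact le_mul_of_one_le_right hX.le (one_le_pow₀ (by norm_num))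
      have hp₁le : 43 / 500 ≤ p₁ := by
        have hx : 1 ≤ m * (1 / (k : ℝ)) := by
          rw [mul_one_div, one_le_div (by linarith)]
          exact_mod_cast hmk.le
        have hp : 43 / 500 ≤ q ^ (m - 1) :=
          (one_sub_inv_pow_two_mul_sub_one_ge hk).trans
            (pow_le_pow_of_le_one (by linarith) hq1 (by omega))
        rw [hp₁]
        nlinarith
      have hYc : p₀ * (6 / 5) + (1 - p₀ - 2 / 3 * p₁) * (5 / 6) ≤ 24 / 25 := by linarith
      have hsum : p₀ * (5 / 6) + (1 - p₀ - 2 / 3 * p₁) * (6 / 5) + (p₀ * (6 / 5) +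
          (1 - p₀ - 2 / 3 * p₁) * (5 / 6)) ≤ 48 / 25 := by linarith
      nlinarith
    -- For `m > 2 k` silence is rare, about `e⁻²` at most, and `Y` dominates `X`; again no success
    -- is needed. The exponent `6` comes from `m - k ≥ k + 1 ≥ 3`.
    · have h6 : (6 / 5 : ℝ) ^ 6 ≤ (6 / 5 : ℝ) ^ (2 * (m - k)) :=
        pow_le_pow_right₀ (by norm_num) (by omega)
      have h6' : (29 / 10 : ℝ) ≤ (6 / 5 : ℝ) ^ 6 := by norm_num
      have h4 : 29 / 10 * X ≤ Y := by
        rw [hj]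
        nlinarith
      have hp : p₀ ≤ 14 / 100 := by
        have h1 : q ^ m ≤ q ^ (2 * k) := pow_le_pow_of_le_one (by linarith) hq1 h2.le
        have h3 : 0 ≤ q ^ k := by positivity
        rw [mul_comm 2 k, pow_mul] at h1
        rw [hp₀]
        nlinarith
      have hmain : p₀ * (X * (5 / 6) + Y * (6 / 5)) + (1 - p₀) * (X * (6 / 5) + Y * (5 / 6)) ≤
          24 / 25 * (X + Y) := by
        have := mul_le_mul_of_nonneg_right hp (by linarith : 0 ≤ Y - X)
        linarith
      have hnonneg : 0 ≤ p₁ * (X * (6 / 5) + Y * (5 / 6)) := by positivity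
      linear_combination hmain + 2 / 3 * hnonneg

end Binomial

theorem potential_drift {m k : ℕ} (hm : 1 ≤ m) (hk : 2 ≤ k) {p₀ p₁ : ℝ}
    (hp₀ : p₀ = (1 - 1 / (k : ℝ)) ^ m)
    (hp₁ : p₁ = m * (1 / (k : ℝ)) * (1 - 1 / (k : ℝ)) ^ (m - 1)) :
    p₀ * potential m (if k > 2 then k - 1 else k) + p₁ * potential (m - 1) k +
      (1 - p₀ - p₁) * potential m (k + 1) ≤ 24 / 25 * potential m k := by
  have hm0 : m ≠ 0 := by omega
  -- The only state with `k > m` in which silence cannot lower `k`. Here a collision is impossible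
  -- and a success has probability `1/2`.
  by_cases h12 : m = 1 ∧ k = 2
  · obtain ⟨rfl, rfl⟩ := h12
    norm_num at hp₀ hp₁
    have := potential_nonneg 1 2
    norm_num [hp₀, hp₁]
    have h0 : potential 0 2 = 0 := by simp [potential]
    rw [h0]
    linarith
  have hk2 : (2 : ℝ) ≤ k := by exact_mod_cast hk
  have hik : 1 / (k : ℝ) ≤ 1 / 2 := one_div_le_one_div_of_le (by norm_num) hk2
  have hq0 : (0 : ℝ) ≤ 1 - 1 / (k : ℝ) := by linarith
  have hp₀0 : 0 ≤ p₀ := by rw [hp₀]; positivity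
  have hp₁0 : 0 ≤ p₁ := by rw [hp₁]; positivity
  obtain ⟨X, hX⟩ : ∃ X, X = (6 / 5 : ℝ) ^ ((k : ℤ) - m) := ⟨_, rfl⟩
  obtain ⟨Y, hY⟩ : ∃ Y, Y = (6 / 5 : ℝ) ^ ((m : ℤ) - k) := ⟨_, rfl⟩
  have hXpos : 0 < X := by rw [hX]; positivity
  have hYpos : 0 < Y := by rw [hY]; positivity
  have hdrift := drift_aux hm hk hXpos hYpos hp₀ hp₁ hX hY
  have hup : ∀ z : ℤ, (6 / 5 : ℝ) ^ (z + 1) = (6 / 5 : ℝ) ^ z * (6 / 5) := fun z =>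
    zpow_add_one₀ (by norm_num) z
  have hdown : ∀ z : ℤ, (6 / 5 : ℝ) ^ (z - 1) = (6 / 5 : ℝ) ^ z * (5 / 6) := fun z => by
    rw [zpow_sub_one₀ (by norm_num)]
    norm_num
  have hF : potential m k = 3 ^ m * (X + Y) := by simp [potential, hm0, hX, hY]
  have hFc : potential m (k + 1) = 3 ^ m * (X * (6 / 5) + Y * (5 / 6)) := by
    rw [potential, if_neg hm0, hX, hY, ← hup, ← hdown]
    congr 3 <;> push_cast <;> ring
  -- A success shifts `k - m` by one just as a collision does, but gains a factor `3`. At `m = 1`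
  -- the left side is `0`, hence only an inequality.
  have hF1 : potential (m - 1) k ≤ 3 ^ m * ((X * (6 / 5) + Y * (5 / 6)) / 3) := by
    unfold potential
    split_ifs with h
    · positivity
    · apply le_of_eq
      obtain ⟨j, rfl⟩ : ∃ j, m = j + 1 := ⟨m - 1, by omega⟩
      rw [hX, hY, ← hup, ← hdown, Nat.add_sub_cancel, pow_succ]
      have e1 : (k : ℤ) - (j : ℤ) = (k : ℤ) - ((j + 1 : ℕ) : ℤ) + 1 := by push_cast; ring
      have e2 : (j : ℤ) - (k : ℤ) = ((j + 1 : ℕ) : ℤ) - (k : ℤ) - 1 := by push_cast; ring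
      rw [e1, e2]
      ring
  have hF0 : potential m (if k > 2 then k - 1 else k) ≤ 3 ^ m * (X * (5 / 6) + Y * (6 / 5)) := by
    split_ifs with h
    · apply le_of_eq
      rw [potential, if_neg hm0, hX, hY, ← hup, ← hdown, Nat.cast_sub (by omega)]
      congr 3 <;> push_cast <;> ring
    -- Here `k = 2` and `m ≥ 2`, so `X ≤ Y` and staying at `k` costs no more than the unclamped
    -- decrease would.
    · rw [hF]
      have hXY : X ≤ Y := by
        rw [hX, hY]
        exact zpow_le_zpow_right₀ (by norm_num) (by omega)
      have : X + Y ≤ X * (5 / 6) + Y * (6 / 5) := by linarith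
      gcongr
  have hpc : 0 ≤ 1 - p₀ - p₁ := by
    have hb : p₀ + p₁ ≤ 1 := by
      have hsum := add_pow (1 / (k : ℝ)) (1 - 1 / (k : ℝ)) m
      rw [add_sub_cancel, one_pow] at hsum
      have hik0 : 0 ≤ 1 / (k : ℝ) := by positivity
      have h2 : ∑ i ∈ Finset.range 2, (1 / (k : ℝ)) ^ i * (1 - 1 / (k : ℝ)) ^ (m - i) *
          (m.choose i : ℝ) ≤ 1 := by
        refine le_of_le_of_eq ?_ hsum.symm
        exact Finset.sum_le_sum_of_subset_of_nonneg (Finset.range_mono (by omega))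
          fun i _ _ => mul_nonneg (mul_nonneg (pow_nonneg hik0 _) (pow_nonneg hq0 _))
            (Nat.cast_nonneg _)
      rw [Finset.sum_range_succ, Finset.sum_range_one] at h2
      simp only [pow_zero, pow_one, Nat.sub_zero, Nat.choose_zero_right, Nat.choose_one_right,
        Nat.cast_one] at h2
      rw [hp₀, hp₁]
      linarith
    linarith
  calc _ ≤ p₀ * (3 ^ m * (X * (5 / 6) + Y * (6 / 5))) +
        p₁ * (3 ^ m * ((X * (6 / 5) + Y * (5 / 6)) / 3)) +
        (1 - p₀ - p₁) * (3 ^ m * (X * (6 / 5) + Y * (5 / 6))) := by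
        rw [hFc]
        gcongr
    _ = 3 ^ m * (p₀ * (X * (5 / 6) + Y * (6 / 5)) +
        (p₁ / 3 + (1 - p₀ - p₁)) * (X * (6 / 5) + Y * (5 / 6))) := by ring
    _ ≤ 3 ^ m * (24 / 25 * (X + Y)) := by gcongr
    _ = 24 / 25 * potential m k := by rw [hF]; ring

/-! ### The law of a phase, decay of the expected potential, and tail bounds -/

namespace CountState

variable {V : Type*}

instance : MeasurableSpace (CountState V) := ⊤

instance : DiscreteMeasurableSpace (CountState V) := ⟨fun _ => trivial⟩

instance : MeasurableSpace (Finset V) := ⊤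

instance : DiscreteMeasurableSpace (Finset V) := ⟨fun _ => trivial⟩

theorem two_le_k_next {s : CountState V} (hs : 2 ≤ s.k) (u : V → unitInterval) :
    2 ≤ (s.next u).k := by
  unfold next
  split_ifs
  all_goals first
    | exact hs
    | (dsimp only; omega)

theorem beepers_eq_iff (s : CountState V) (B : Finset V) (u : V → unitInterval) :
    s.beepers u = B ↔ ∀ v, v ∈ s.uncounted ∧ (u v : ℝ) < 1 / (s.k : ℝ) ↔ v ∈ B := by
  simp [beepers, Finset.ext_iff]

open Classical in
/-- The global state after a phase in which the nodes of `B` beep in slot 1. -/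
noncomputable def nextOf (s : CountState V) (B : Finset V) : CountState V :=
  if s.uncounted = ∅ then s
  else if B.card = 0 then ⟨s.uncounted, if s.k > 2 then s.k - 1 else s.k⟩
  else if B.card = 1 then ⟨s.uncounted \ B, s.k⟩
  else ⟨s.uncounted, s.k + 1⟩

theorem next_eq_nextOf (s : CountState V) (u : V → unitInterval) :
    s.next u = s.nextOf (s.beepers u) := rfl

variable [Fintype V]

instance : Countable (CountState V) :=
  Function.Injective.countable (f := fun s : CountState V => (s.uncounted, s.k))
    fun _ _ h => CountState.ext (Prod.ext_iff.1 h).1 (Prod.ext_iff.1 h).2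

theorem two_le_k_after (ω : ℕ → V → unitInterval) (t : ℕ) : 2 ≤ (after ω t).k := by
  induction t with
  | zero => simp [after]
  | succ t ih => exact two_le_k_next ih _

theorem after_congr {ω ω' : ℕ → V → unitInterval} {t : ℕ} (h : ∀ i < 3 * t, ω i = ω' i) :
    after ω t = after ω' t := by
  induction t with
  | zero => rfl
  | succ t ih =>
    simp only [after]
    rw [ih fun i hi => h i (by omega), h (3 * t) (by omega)]

theorem measurable_beepers (s : CountState V) : Measurable s.beepers := by
  refine measurable_to_countable' fun B => ?_
  have : s.beepers ⁻¹' {B} =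
      ⋂ v, {u : V → unitInterval | v ∈ s.uncounted ∧ (u v : ℝ) < 1 / (s.k : ℝ) ↔ v ∈ B} := by
    ext u
    simp only [Set.mem_preimage, Set.mem_singleton_iff, beepers_eq_iff, Set.mem_iInter,
      Set.mem_ofPred_eq]
  rw [this]
  refine MeasurableSet.iInter fun v => ?_
  have hlt : MeasurableSet {u : V → unitInterval | (u v : ℝ) < 1 / (s.k : ℝ)} :=
    measurableSet_lt (by fun_prop) measurable_const
  by_cases hv : v ∈ s.uncounted <;> by_cases hB : v ∈ B
  · simpa [hv, hB] using hlt
  · simp only [hv, hB, true_and, iff_false]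
    exact hlt.compl
  · simp [hv, hB]
  · simp [hv, hB]

theorem measurable_next :
    Measurable fun p : CountState V × (V → unitInterval) => p.1.next p.2 :=
  measurable_from_prod_countable_right fun s =>
    (measurable_of_countable s.nextOf).comp s.measurable_beepers

theorem measurable_after (t : ℕ) :
    Measurable fun ω : ℕ → V → unitInterval => after ω t := by
  induction t with
  | zero => exact measurable_const
  | succ t ih => exact measurable_next.comp (ih.prodMk (measurable_pi_apply (3 * t)))

/-- The state after `t` phases uses only slots before `3 * t`, and distinct slots are independent.
-/
theorem indepFun_after (t : ℕ) :
    ProbabilityTheory.IndepFun (fun ω : ℕ → V → unitInterval => after ω t)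
      (fun ω => ω (3 * t)) (randomness V) := by
  have h := ProbabilityTheory.iIndepFun_infinitePi
    (P := fun _ : ℕ => Measure.pi fun _ : V => (volume : Measure unitInterval))
    (X := fun _ x => x) (fun _ => measurable_id)
  have h2 := h.indepFun_finset (Finset.range (3 * t)) {3 * t} (by simp)
    (fun i => measurable_pi_apply i)
  -- Padding with an arbitrary value, here `0`, exhibits `after` as a measurable function of the
  -- first `3 * t` coordinates.
  let extend : (Finset.range (3 * t) → V → unitInterval) → ℕ → V → unitInterval :=
    fun y i => if hi : i ∈ Finset.range (3 * t) then y ⟨i, hi⟩ else fun _ => 0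
  have hext : Measurable extend := by
    refine measurable_pi_lambda _ fun i => ?_
    by_cases hi : i ∈ Finset.range (3 * t)
    · simp only [extend, hi, dif_pos]
      exact measurable_pi_apply _
    · simp only [extend, hi, dif_neg, not_false_eq_true]
      exact measurable_const
  have h3 := h2.comp ((measurable_after t).comp hext)
    (measurable_pi_apply (⟨3 * t, Finset.mem_singleton_self _⟩ : ({3 * t} : Finset ℕ)))
  refine (congrArg (fun X : (ℕ → V → unitInterval) → CountState V =>
    ProbabilityTheory.IndepFun X (fun ω => ω (3 * t)) (randomness V)) ?_).mpr h3
  funext ω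
  refine after_congr fun i hi => ?_
  have hi' : i ∈ Finset.range (3 * t) := Finset.mem_range.2 hi
  simp only [extend, hi', dif_pos]

/-- The event is a box, with independent coordinates constrained to `[0, 1/k)`, to `[1/k, 1]`, or
not at all. -/
theorem measure_beepers_eq {s : CountState V} (hk : 2 ≤ s.k) {B : Finset V}
    (hB : B ⊆ s.uncounted) :
    (Measure.pi fun _ : V => (volume : Measure unitInterval)) (s.beepers ⁻¹' {B}) =
      ENNReal.ofReal ((1 / (s.k : ℝ)) ^ B.card *
        (1 - 1 / (s.k : ℝ)) ^ (s.uncounted.card - B.card)) := by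
  classical
  have hk2 : (2 : ℝ) ≤ s.k := by exact_mod_cast hk
  have hc0 : 0 ≤ 1 / (s.k : ℝ) := by positivity
  have hc1 : 1 / (s.k : ℝ) ≤ 1 := by
    rw [div_le_one (by linarith)]
    linarith
  let c : unitInterval := ⟨1 / (s.k : ℝ), hc0, hc1⟩
  have hset : s.beepers ⁻¹' {B} = Set.univ.pi fun v =>
      if v ∈ B then Set.Iio c else if v ∈ s.uncounted then Set.Ici c else Set.univ := by
    ext u
    simp only [Set.mem_preimage, Set.mem_singleton_iff, beepers_eq_iff, Set.mem_pi, Set.mem_univ,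
      true_implies]
    refine forall_congr' fun v => ?_
    by_cases hv : v ∈ B
    · simp [hv, hB hv, c, ← Subtype.coe_lt_coe]
    · by_cases hvs : v ∈ s.uncounted
      · simp [hv, hvs, c, ← Subtype.coe_le_coe]
      · simp [hv, hvs]
  rw [hset, Measure.pi_pi]
  have hfac : ∀ v : V, (volume : Measure unitInterval)
      (if v ∈ B then Set.Iio c else if v ∈ s.uncounted then Set.Ici c else Set.univ) =
      (if v ∈ B then ENNReal.ofReal (1 / (s.k : ℝ)) else 1) *
        (if v ∈ s.uncounted \ B then ENNReal.ofReal (1 - 1 / (s.k : ℝ)) else 1) := by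
    intro v
    by_cases hv : v ∈ B
    · simp only [hv, if_true, unitInterval.volume_Iio, Finset.mem_sdiff, not_true, and_false,
        if_false, mul_one, c]
    · by_cases hvs : v ∈ s.uncounted
      · simp only [hv, if_false, hvs, if_true, unitInterval.volume_Ici, Finset.mem_sdiff, not_false_eq_true,
          and_true, one_mul, c]
      · simp [hv, hvs]
  rw [Finset.prod_congr rfl fun v _ => hfac v, Finset.prod_mul_distrib, Finset.prod_ite_mem,
    Finset.prod_ite_mem, Finset.univ_inter, Finset.univ_inter, Finset.prod_const,
    Finset.prod_const, Finset.card_sdiff_of_subset hB, ENNReal.ofReal_mul (by positivity),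
    ENNReal.ofReal_pow hc0, ENNReal.ofReal_pow (by linarith)]

/-- The potential of a global state. -/
noncomputable def energy (s : CountState V) : ℝ := potential s.uncounted.card s.k

/-- The number of beepers is binomial and the new energy depends only on whether it is `0`, `1` or
more, which reduces the claim to `potential_drift`. -/
theorem lintegral_energy_next_le {s : CountState V} (hk : 2 ≤ s.k) :
    ∫⁻ u, ENNReal.ofReal (s.next u).energy
        ∂(Measure.pi fun _ : V => (volume : Measure unitInterval)) ≤
      ENNReal.ofReal (24 / 25) * ENNReal.ofReal s.energy := by
  classical
  by_cases hs : s.uncounted = ∅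
  · simp [next, hs, energy, potential]
  have hk2 : (2 : ℝ) ≤ s.k := by exact_mod_cast hk
  have hc0 : 0 ≤ 1 / (s.k : ℝ) := by positivity
  have hc1 : 0 ≤ 1 - 1 / (s.k : ℝ) := by
    rw [sub_nonneg, div_le_one (by linarith)]
    linarith
  let h : ℕ → ℝ := fun j =>
    if j = 0 then potential s.uncounted.card (if s.k > 2 then s.k - 1 else s.k)
    else if j = 1 then potential (s.uncounted.card - 1) s.k
    else potential s.uncounted.card (s.k + 1)
  have hh0 : ∀ j, 0 ≤ h j := by
    intro j
    simp only [h]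
    split_ifs <;> exact potential_nonneg _ _
  have hnext : ∀ B ⊆ s.uncounted, (s.nextOf B).energy = h B.card := by
    intro B hB
    simp only [nextOf, hs, if_false, energy, h]
    by_cases h0 : B.card = 0
    · simp only [h0, if_true]
    · by_cases h1 : B.card = 1
      · simp only [h1, if_true, one_ne_zero, if_false, Finset.card_sdiff_of_subset hB]
      · simp only [h0, h1, if_false]
  obtain ⟨n, hn⟩ : ∃ n, s.uncounted.card = n + 1 :=
    ⟨s.uncounted.card - 1, by have := Finset.card_ne_zero.2 (Finset.nonempty_iff_ne_empty.2 hs); omega⟩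
  set μ : Measure (V → unitInterval) := Measure.pi fun _ : V => (volume : Measure unitInterval)
  have hmap : ∫⁻ u, ENNReal.ofReal (s.next u).energy ∂μ =
      ∑ B : Finset V, ENNReal.ofReal (s.nextOf B).energy * μ (s.beepers ⁻¹' {B}) := by
    have := lintegral_map (μ := μ) (f := fun B => ENNReal.ofReal (s.nextOf B).energy)
      (measurable_of_countable _) s.measurable_beepers
    simp only [next_eq_nextOf]
    rw [← this, lintegral_fintype]
    refine Finset.sum_congr rfl fun B _ => ?_
    rw [Measure.map_apply s.measurable_beepers (MeasurableSet.singleton B)]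
  have hsub : ∑ B : Finset V, ENNReal.ofReal (s.nextOf B).energy * μ (s.beepers ⁻¹' {B}) =
      ∑ B ∈ s.uncounted.powerset,
        ENNReal.ofReal (s.nextOf B).energy * μ (s.beepers ⁻¹' {B}) := by
    refine (Finset.sum_subset (Finset.subset_univ _) fun B _ hB => ?_).symm
    have : s.beepers ⁻¹' {B} = ∅ := by
      ext u
      simp only [Set.mem_preimage, Set.mem_singleton_iff, Set.mem_empty_iff_false, iff_false]
      rintro rfl
      exact hB (Finset.mem_powerset.2 (s.beepers_subset u))
    simp [this]
  have hreal : ∑ B ∈ s.uncounted.powerset,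
        ENNReal.ofReal (s.nextOf B).energy * μ (s.beepers ⁻¹' {B}) =
      ENNReal.ofReal (∑ B ∈ s.uncounted.powerset, h B.card * ((1 / (s.k : ℝ)) ^ B.card *
        (1 - 1 / (s.k : ℝ)) ^ (s.uncounted.card - B.card))) := by
    rw [ENNReal.ofReal_sum_of_nonneg]
    · refine Finset.sum_congr rfl fun B hB => ?_
      rw [measure_beepers_eq hk (Finset.mem_powerset.1 hB), hnext B (Finset.mem_powerset.1 hB),
        ENNReal.ofReal_mul (hh0 _)]
    · intro B _
      exact mul_nonneg (hh0 _) (mul_nonneg (pow_nonneg hc0 _) (pow_nonneg hc1 _))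
  have hbinom : ∑ B ∈ s.uncounted.powerset, h B.card * ((1 / (s.k : ℝ)) ^ B.card *
        (1 - 1 / (s.k : ℝ)) ^ (s.uncounted.card - B.card)) ≤ 24 / 25 * s.energy := by
    rw [Finset.sum_powerset_apply_card (fun j => h j * ((1 / (s.k : ℝ)) ^ j *
        (1 - 1 / (s.k : ℝ)) ^ (s.uncounted.card - j)))]
    refine le_of_eq_of_le ?_ (potential_drift (m := s.uncounted.card) (by omega) hk rfl rfl)
    -- Total mass `1`: peeling off the first two terms identifies the weight of two or more beepers
    -- with `1 - p₀ - p₁`.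
    have htot := add_pow (1 / (s.k : ℝ)) (1 - 1 / (s.k : ℝ)) s.uncounted.card
    rw [add_sub_cancel (1 / (s.k : ℝ)) 1, one_pow, hn, Finset.sum_range_succ',
      Finset.sum_range_succ'] at htot
    rw [hn, Finset.sum_range_succ', Finset.sum_range_succ']
    have htail : ∑ j ∈ Finset.range n, (n + 1).choose (j + 1 + 1) • (h (j + 1 + 1) *
          ((1 / (s.k : ℝ)) ^ (j + 1 + 1) * (1 - 1 / (s.k : ℝ)) ^ (n + 1 - (j + 1 + 1)))) =
        potential (n + 1) (s.k + 1) * ∑ j ∈ Finset.range n, (1 / (s.k : ℝ)) ^ (j + 1 + 1) *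
          (1 - 1 / (s.k : ℝ)) ^ (n + 1 - (j + 1 + 1)) * ((n + 1).choose (j + 1 + 1) : ℝ) := by
      rw [Finset.mul_sum]
      refine Finset.sum_congr rfl fun j _ => ?_
      have : h (j + 1 + 1) = potential (n + 1) (s.k + 1) := by simp [h, hn]
      rw [this, nsmul_eq_mul]
      ring
    have h0 : h 0 = potential (n + 1) (if s.k > 2 then s.k - 1 else s.k) := by simp [h, hn]
    have h1 : h (0 + 1) = potential (n + 1 - 1) s.k := by simp [h, hn]
    rw [htail, h0, h1]
    simp only [nsmul_eq_mul, zero_add, pow_zero, pow_one, Nat.choose_zero_right,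
      Nat.choose_one_right, Nat.cast_one, Nat.sub_zero, one_mul, mul_one] at htot ⊢
    generalize ∑ j ∈ Finset.range n, (1 / (s.k : ℝ)) ^ (j + 1 + 1) *
      (1 - 1 / (s.k : ℝ)) ^ (n + 1 - (j + 1 + 1)) * ((n + 1).choose (j + 1 + 1) : ℝ) = T at *
    linear_combination (-potential (n + 1) (s.k + 1)) * htot
  rw [hmap, hsub, hreal, ← ENNReal.ofReal_mul (by norm_num)]
  exact ENNReal.ofReal_le_ofReal hbinom

instance : IsProbabilityMeasure (randomness V) := by
  unfold randomness
  infer_instance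

/-- By independence and Fubini, the expectation over the current phase can be taken with the past
fixed; the drift bound then iterates. -/
theorem lintegral_energy_after_le (t : ℕ) :
    ∫⁻ ω, ENNReal.ofReal (after ω t).energy ∂(randomness V) ≤
      ENNReal.ofReal ((24 / 25) ^ t * potential (Fintype.card V) 2) := by
  induction t with
  | zero => simp [after, energy]
  | succ t ih =>
    set μ : Measure (V → unitInterval) := Measure.pi fun _ : V => (volume : Measure unitInterval)
      with hμ
    have hg : Measurable fun p : CountState V × (V → unitInterval) =>
        ENNReal.ofReal (p.1.next p.2).energy :=
      (measurable_of_countable fun s : CountState V => ENNReal.ofReal s.energy).comp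
        measurable_next
    have hpair := (measurable_after (V := V) t).prodMk (measurable_pi_apply (3 * t))
    have hlaw := (indepFun_after (V := V) t).map_prod_eq_prod_map_map
      (measurable_after t).aemeasurable (measurable_pi_apply (3 * t)).aemeasurable
    have heval : (randomness V).map (fun ω => ω (3 * t)) = μ :=
      Measure.infinitePi_map_eval _ (3 * t)
    calc ∫⁻ ω, ENNReal.ofReal (after ω (t + 1)).energy ∂(randomness V)
        = ∫⁻ ω, (∫⁻ u, ENNReal.ofReal ((after ω t).next u).energy ∂μ) ∂(randomness V) := by
          rw [heval] at hlaw
          have h1 := lintegral_map (μ := randomness V) hg hpair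
          rw [hlaw, lintegral_prod _ hg.aemeasurable,
            lintegral_map hg.lintegral_prod_right' (measurable_after t)] at h1
          exact h1.symm
      _ ≤ ∫⁻ ω, ENNReal.ofReal (24 / 25) * ENNReal.ofReal (after ω t).energy
            ∂(randomness V) :=
          lintegral_mono fun ω => lintegral_energy_next_le (two_le_k_after ω t)
      _ = ENNReal.ofReal (24 / 25) *
            ∫⁻ ω, ENNReal.ofReal (after ω t).energy ∂(randomness V) :=
          lintegral_const_mul' _ _ ENNReal.ofReal_ne_top
      _ ≤ ENNReal.ofReal (24 / 25) *
            ENNReal.ofReal ((24 / 25) ^ t * potential (Fintype.card V) 2) := by gcongr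
      _ = ENNReal.ofReal ((24 / 25) ^ (t + 1) * potential (Fintype.card V) 2) := by
          rw [← ENNReal.ofReal_mul (by norm_num)]
          congr 1
          ring

theorem measurableSet_uncounted_eq_empty (t : ℕ) :
    MeasurableSet {ω : ℕ → V → unitInterval | (after ω t).uncounted = ∅} :=
  measurable_after t (MeasurableSet.of_discrete (s := {s : CountState V | s.uncounted = ∅}))

/-- Markov's inequality: the indicator of failure is at most the energy. -/
theorem measureReal_uncounted_ne_empty_le (t : ℕ) :
    (randomness V).real {ω | (after ω t).uncounted ≠ ∅} ≤
      (24 / 25) ^ t * potential (Fintype.card V) 2 := by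
  have hnn : 0 ≤ (24 / 25 : ℝ) ^ t * potential (Fintype.card V) 2 :=
    mul_nonneg (by positivity) (potential_nonneg _ _)
  refine ENNReal.toReal_le_of_le_ofReal hnn (le_trans ?_ (lintegral_energy_after_le t))
  have hcompl : {ω : ℕ → V → unitInterval | (after ω t).uncounted ≠ ∅} =
      {ω | (after ω t).uncounted = ∅}ᶜ := rfl
  rw [hcompl, ← lintegral_indicator_one (measurableSet_uncounted_eq_empty t).compl]
  refine lintegral_mono fun ω => ?_
  refine Set.indicator_apply_le' (fun hω => ?_) fun _ => zero_le
  rw [Pi.one_apply, ENNReal.one_le_ofReal]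
  exact one_le_potential (Finset.card_ne_zero.2 (Finset.nonempty_iff_ne_empty.2 hω)) _

theorem ae_exists_uncounted_eq_empty :
    ∀ᵐ ω ∂(randomness V), ∃ t, (after ω t).uncounted = ∅ := by
  rw [ae_iff, ← measureReal_eq_zero_iff]
  refine le_antisymm ?_ measureReal_nonneg
  have hlim : Tendsto (fun t : ℕ => (24 / 25 : ℝ) ^ t * potential (Fintype.card V) 2) atTop
      (nhds 0) := by
    simpa using (tendsto_pow_atTop_nhds_zero_of_lt_one (by norm_num : (0 : ℝ) ≤ 24 / 25)
      (by norm_num)).mul_const (potential (Fintype.card V) 2)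
  refine ge_of_tendsto' hlim fun t => le_trans ?_ (measureReal_uncounted_ne_empty_le t)
  refine measureReal_mono fun ω hω => ?_
  simp only [Set.mem_ofPred_eq, not_exists] at hω
  exact hω t

end CountState

/-! ### Numerical bounds and the conclusion -/

theorem pow_mul_potential_two_le (n : ℕ) :
    (24 / 25 : ℝ) ^ (55 * n) * potential n 2 ≤ 2 * (1 / 2) ^ n := by
  rcases Nat.eq_zero_or_pos n with rfl | hn
  · simp [potential]
  have hpot : potential n 2 ≤ 2 * (18 / 5) ^ n := by
    have h1 : (6 / 5 : ℝ) ^ (((2 : ℕ) : ℤ) - n) ≤ (6 / 5 : ℝ) ^ n := by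
      rw [← zpow_natCast]
      exact zpow_le_zpow_right₀ (by norm_num) (by omega)
    have h2 : (6 / 5 : ℝ) ^ ((n : ℤ) - ((2 : ℕ) : ℤ)) ≤ (6 / 5 : ℝ) ^ n := by
      rw [← zpow_natCast]
      exact zpow_le_zpow_right₀ (by norm_num) (by omega)
    rw [potential, if_neg hn.ne']
    calc _ ≤ 3 ^ n * ((6 / 5 : ℝ) ^ n + (6 / 5 : ℝ) ^ n) := by gcongr
      _ = 2 * (3 * (6 / 5)) ^ n := by rw [mul_pow]; ring
      _ = 2 * (18 / 5) ^ n := by norm_num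
  calc (24 / 25 : ℝ) ^ (55 * n) * potential n 2
      ≤ (24 / 25 : ℝ) ^ (55 * n) * (2 * (18 / 5) ^ n) := by gcongr
    _ = 2 * ((24 / 25 : ℝ) ^ 55 * (18 / 5)) ^ n := by
        rw [mul_pow, pow_mul]
        ring
    -- The constant `55` enters here: `(24/25) ^ 55 * (18/5)` is below `1/2`.
    _ ≤ 2 * (1 / 2) ^ n := by
        gcongr
        norm_num

theorem two_mul_half_pow_isLittleO :
    (fun n : ℕ => 2 * (1 / 2 : ℝ) ^ n) =o[atTop] fun n : ℕ => (n : ℝ)⁻¹ := by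
  refine IsLittleO.const_mul_left ?_ 2
  rw [isLittleO_iff_tendsto']
  · simpa [mul_comm] using tendsto_self_mul_const_pow_of_lt_one
      (by norm_num : (0 : ℝ) ≤ 1 / 2) (by norm_num)
  · filter_upwards [eventually_ne_atTop 0] with n hn h
    exact absurd h (by positivity)

end Beeping

/-- On complete graphs with `n` nodes the counting algorithm is a Las Vegas algorithm for the size,
and with probability `1 - o(1/n)` it ends within `55 n` phases of three slots, that is within
`165 n` slots. -/
theorem theorem1 :
    ∃ ε : ℕ → ℝ, ε =o[atTop] (fun n : ℕ => (n : ℝ)⁻¹) ∧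
      ∀ (V : Type*) [Fintype V],
        (∀ (ω : ℕ → V → unitInterval) (t : ℕ) (v : V),
          Beeping.counting.terminated (Beeping.config Beeping.counting (⊤ : SimpleGraph V) ω t v) →
          Beeping.counting.output (Beeping.config Beeping.counting (⊤ : SimpleGraph V) ω t v) =
            Fintype.card V) ∧
        (∀ᵐ ω ∂(Beeping.randomness V),
          ∃ t, Beeping.Solved Beeping.counting (⊤ : SimpleGraph V) ω t) ∧
        1 - ε (Fintype.card V) ≤ (Beeping.randomness V).real
          {ω | (∃ p ≤ 55 * Fintype.card V,
                  Beeping.Solved Beeping.counting (⊤ : SimpleGraph V) ω (3 * p)) ∧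
               (∃ t ≤ 165 * Fintype.card V,
                  Beeping.Solved Beeping.counting (⊤ : SimpleGraph V) ω t)} := by
  refine ⟨fun n => 2 * (1 / 2) ^ n, Beeping.two_mul_half_pow_isLittleO, fun V _ =>
    ⟨Beeping.CountState.output_eq_of_terminated, ?_, ?_⟩⟩
  · filter_upwards [Beeping.CountState.ae_exists_uncounted_eq_empty (V := V)] with ω ⟨t, ht⟩
    exact ⟨3 * t, Beeping.CountState.solved_three_mul ω t ht⟩
  · set n := Fintype.card V
    have hfail := (Beeping.CountState.measureReal_uncounted_ne_empty_le (V := V) (55 * n)).trans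
      (Beeping.pow_mul_potential_two_le n)
    have hcompl := probReal_compl_eq_one_sub (μ := Beeping.randomness V)
      (Beeping.CountState.measurableSet_uncounted_eq_empty (55 * n))
    rw [Set.compl_ofPred] at hcompl
    -- Finished states are frozen, so the single measurable event at phase `55 n` suffices;
    -- monotonicity then needs no measurability of the target event.
    refine le_trans (b := (Beeping.randomness V).real
      {ω | (Beeping.CountState.after ω (55 * n)).uncounted = ∅}) (by linarith)
      (measureReal_mono fun ω hω => ?_)
    have hsolved := Beeping.CountState.solved_three_mul ω (55 * n) hω
    exact ⟨⟨55 * n, le_rfl, hsolved⟩, ⟨3 * (55 * n), by omega, hsolved⟩⟩
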